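/- Consider a rooted tree with buses $0,1,\dots,n$ and root $0$; write $\pi(j)$ for the parent of a bus $j\neq 0$, $\delta(j)$ for the set of children of $j$, and $E=\{(\pi(j),j): j\ne 0\}$ for its lines. Each line $(i,j)\in E$ has a resistance $r_{ij}\ge 0$ and a reactance $x_{ij}\ge 0$. The variables are real numbers $p_{ij},q_{ij},\ell_{ij}$ for $(i,j)\in E$ (sending-end active and reactive power, squared current magnitude) and $v_i,p_i,q_i$ for each bus $i$ (squared voltage magnitude, net active and reactive power demand), and the relaxed branch flow equations are $$p_j = p_{\pi(j)j}-r_{\pi(j)j}\ell_{\pi(j)j}-\sum_{k\in\delta(j)}p_{jk},\qquad q_j = q_{\pi(j)j}-x_{\pi(j)j}\ell_{\pi(j)j}-\sum_{k\in\delta(j)}q_{jk}$$ for every bus $j$ (for $j=0$ the terms with $\pi(0)0$ are $0$), and $$v_j=v_i-2(r_{ij}p_{ij}+x_{ij}q_{ij})+(r_{ij}^2+x_{ij}^2)\ell_{ij},\qquad v_i\ell_{ij}=p_{ij}^2+q_{ij}^2$$ for every $(i,j)\in E$. Put $u=(\overline p,\overline q,\ell,v_{1\ldots n},p_0,q_0)\in\mathbb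 R^{4n+2}$, where $\overline p=(p_{ij})$, $\overline q=(q_{ij})$, $\ell=(\ell_{ij})$ over the lines, and $\xi=(v_0,p_{1\ldots n},q_{1\ldots n})$. Write the equations as $\varphi(u,\xi)=0$, with $\varphi$ equal to right-hand side minus left-hand side, and let $\varphi_u=\partial\varphi/\partial u$. The flat voltage solution is $v=\mathbf 1$, all other variables $0$. The voltage stability region of the network with PQ loads is the connected component of the flat voltage solution in the set of all $(u,\xi)$ with $\varphi(u,\xi)=0$, $v_0=1$, $p_j\ge 0$ and $q_j\ge0$ for $j=1,\dots,n$, and $\det\varphi_u\neq0$. Let $A^o$ and $A^i$ be the $(n+1)\times n$ matrices, with rows indexed by buses and columns by lines, whose entry at bus $k$ and line $(i,j)$ is $1$ if $k=i$, respectively if $k=j$, and $0$ otherwise. Put $A=A^o-A^i$, and let $A_2^o$, $A_2$ be $A^o$, $A$ without the row of bus $0$; write $[y]$ for the diagonal matrix with diagonal $y$. The reduced power flow Jacobian is $$\varphi_u'=[A^{oT}v]+2[\overline p]A_2^{-1}[r]+2[\overline q]A_2^{-1}[x]-[\ell]A_2^{oT}(A_2^T)^{-1}\big([r]^2+2[r]A_2^{-1}[r]+[x]^2+2[x]A_2^{-1}[x]\big).$$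 Then at every point of the voltage stability region (in particular at those with positive active and reactive demand at all buses $1,\dots,n$) the diagonal entries of $\varphi'_u$ are $$\varphi'_{u,jj}=v_i-2p_{ij}r_{ij}-2q_{ij}x_{ij}-2\ell_{ij}\big(r_{ij}\overline{r_{0i}}+x_{ij}\overline{x_{0i}}\big),\qquad i=\pi(j),$$ where $\overline{r_{0i}}$ and $\overline{x_{0i}}$ are the sums of the resistances and of the reactances of the lines connecting bus $0$ to bus $i$, and $$0<\det(\varphi_u')\le{\det}_{\mathrm{approx}}:=\prod_{(i,j)\in E}\varphi'_{u,jj}.$$ -/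

import Mathlib

open Matrix

/-- One step towards the root `0`: the root stays where it is, the bus `j.succ` moves to its parent. -/
def towardsRoot {n : ℕ} (parent : Fin n → Fin (n + 1)) : Fin (n + 1) → Fin (n + 1) :=
  Fin.cons (α := fun _ => Fin (n + 1)) 0 parent

/-- A radial distribution network with buses `0, 1, …, n`, where bus `0` is the root (the substation).
The bus `j.succ` (for `j : Fin n`) has the unique parent `parent j`; the line from `parent j` to
`j.succ` is indexed by `j`, and `r j`, `x j` are its resistance and reactance. -/
structure RadialNetwork (n : ℕ) where
  parent : Fin n → Fin (n + 1)
  reaches_root : ∀ i : Fin (n + 1), ∃ k : ℕ, (towardsRoot parent)^[k] i = 0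
  r : Fin n → ℝ
  x : Fin n → ℝ
  r_nonneg : ∀ j, 0 ≤ r j
  x_nonneg : ∀ j, 0 ≤ x j

/-- Positions of the vector of system variables `u = (p̄, q̄, ℓ, v₁…vₙ, p₀, q₀)`, in this order. -/
abbrev VarIdx (n : ℕ) : Type := Fin n ⊕ Fin n ⊕ Fin n ⊕ Fin n ⊕ Fin 1 ⊕ Fin 1

/-- Positions of the vector of system parameters `ξ = (v₀, p₁…pₙ, q₁…qₙ)`, in this order. -/
abbrev ParIdx (n : ℕ) : Type := Fin 1 ⊕ Fin n ⊕ Fin n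

/-- Positions of the branch flow equations: active power balance, reactive power balance,
voltage drop, and current equation, in this order. -/
abbrev EqIdx (n : ℕ) : Type := Fin (n + 1) ⊕ Fin (n + 1) ⊕ Fin n ⊕ Fin n

abbrev Vars (n : ℕ) : Type := VarIdx n → ℝ

abbrev Params (n : ℕ) : Type := ParIdx n → ℝ

namespace Vars

variable {n : ℕ}

/-- Sending-end active power of each line. -/
def pLine (u : Vars n) : Fin n → ℝ := fun j => u (.inl j)

/-- Sending-end reactive power of each line. -/
def qLine (u : Vars n) : Fin n → ℝ := fun j => u (.inr (.inl j))

/-- Squared current magnitude of each line. -/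
def ell (u : Vars n) : Fin n → ℝ := fun j => u (.inr (.inr (.inl j)))

/-- Squared voltage magnitude at the PQ buses `1, …, n`. -/
def vPQ (u : Vars n) : Fin n → ℝ := fun j => u (.inr (.inr (.inr (.inl j))))

/-- Active power demand at the slack bus. -/
def pSlack (u : Vars n) : ℝ := u (.inr (.inr (.inr (.inr (.inl 0)))))

/-- Reactive power demand at the slack bus. -/
def qSlack (u : Vars n) : ℝ := u (.inr (.inr (.inr (.inr (.inr 0)))))

end Vars

namespace Params

variable {n : ℕ}

/-- Squared voltage magnitude at the slack bus. -/
def vSlack (ξ : Params n) : ℝ := ξ (.inl 0)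

/-- Active power demand (load minus generation) at the PQ buses. -/
def pPQ (ξ : Params n) : Fin n → ℝ := fun j => ξ (.inr (.inl j))

/-- Reactive power demand at the PQ buses. -/
def qPQ (ξ : Params n) : Fin n → ℝ := fun j => ξ (.inr (.inr j))

end Params

/-- The vector `v` of squared voltage magnitudes at all buses `0, …, n`. -/
def busV {n : ℕ} (u : Vars n) (ξ : Params n) : Fin (n + 1) → ℝ :=
  Fin.cons (α := fun _ => ℝ) ξ.vSlack u.vPQ

/-- The vector `p` of active power demands at all buses. -/
def busP {n : ℕ} (u : Vars n) (ξ : Params n) : Fin (n + 1) → ℝ :=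
  Fin.cons (α := fun _ => ℝ) u.pSlack ξ.pPQ

/-- The vector `q` of reactive power demands at all buses. -/
def busQ {n : ℕ} (u : Vars n) (ξ : Params n) : Fin (n + 1) → ℝ :=
  Fin.cons (α := fun _ => ℝ) u.qSlack ξ.qPQ

/-- The variables of the flat voltage solution: all voltages `1`, everything else `0`. -/
def flatVars (n : ℕ) : Vars n :=
  Sum.elim 0 (Sum.elim 0 (Sum.elim 0 (Sum.elim 1 (Sum.elim 0 0))))

/-- The parameters of the flat voltage solution: `v₀ = 1` and no demand. -/
def flatParams (n : ℕ) : Params n :=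
  Sum.elim 1 (Sum.elim 0 0)

/-- The parameters for which no PQ bus generates active or reactive power. It is the closure of the
set of parameters with positive demand at all PQ buses, and contains those of the flat voltage
solution. -/
def loadParams (n : ℕ) : Set (Params n) :=
  {ξ | ∀ j, 0 ≤ ξ.pPQ j ∧ 0 ≤ ξ.qPQ j}

/-- Stacking order of the equations. -/
def eqOrder (n : ℕ) : EqIdx n ≃ Fin (4 * n + 2) :=
  (((Equiv.refl _).sumCongr (((Equiv.refl _).sumCongr finSumFinEquiv).trans finSumFinEquiv)).trans
    finSumFinEquiv).trans (finCongr (by omega))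

/-- Stacking order of the variables. -/
def varOrder (n : ℕ) : VarIdx n ≃ Fin (4 * n + 2) :=
  (((Equiv.refl _).sumCongr (((Equiv.refl _).sumCongr (((Equiv.refl _).sumCongr
    (((Equiv.refl _).sumCongr finSumFinEquiv).trans finSumFinEquiv)).trans
      finSumFinEquiv)).trans finSumFinEquiv)).trans finSumFinEquiv).trans (finCongr (by omega))

noncomputable section

namespace RadialNetwork

variable {n : ℕ} (net : RadialNetwork n)

/-- `Aⁱ` selects for each bus the line that enters it. -/
def Ai (_net : RadialNetwork n) : Matrix (Fin (n + 1)) (Fin n) ℝ :=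
  Matrix.of fun i j => if i = j.succ then 1 else 0

/-- `Aᵒ` selects for each bus the lines that leave it. -/
def Ao : Matrix (Fin (n + 1)) (Fin n) ℝ :=
  Matrix.of fun i j => if i = net.parent j then 1 else 0

/-- The incidence matrix. -/
def A : Matrix (Fin (n + 1)) (Fin n) ℝ := net.Ao - net.Ai

/-- `Aᵒ` without the row of the root. -/
def Ao2 : Matrix (Fin n) (Fin n) ℝ := net.Ao.submatrix Fin.succ id

/-- `A` without the row of the root. -/
def A2 : Matrix (Fin n) (Fin n) ℝ := net.A.submatrix Fin.succ id

/-- The relaxed branch flow model in implicit form: right-hand side minus left-hand side of its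
vector equations. -/
def phi (u : Vars n) (ξ : Params n) : EqIdx n → ℝ :=
  Sum.elim
    (net.Ai *ᵥ (u.pLine - diagonal net.r *ᵥ u.ell) - net.Ao *ᵥ u.pLine - busP u ξ)
    (Sum.elim
      (net.Ai *ᵥ (u.qLine - diagonal net.x *ᵥ u.ell) - net.Ao *ᵥ u.qLine - busQ u ξ)
      (Sum.elim
        (net.Aoᵀ *ᵥ busV u ξ
          - (2 : ℝ) • (diagonal net.r *ᵥ u.pLine + diagonal net.x *ᵥ u.qLine)
          + (diagonal net.r ^ 2 + diagonal net.x ^ 2) *ᵥ u.ell - net.Aiᵀ *ᵥ busV u ξ)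
        (diagonal u.pLine *ᵥ u.pLine + diagonal u.qLine *ᵥ u.qLine
          - diagonal (net.Aoᵀ *ᵥ busV u ξ) *ᵥ u.ell)))

/-- The power flow Jacobian `φ_u = ∂φ/∂u`, a square matrix of size `4 n + 2`. -/
def jacobian (u : Vars n) (ξ : Params n) : Matrix (Fin (4 * n + 2)) (Fin (4 * n + 2)) ℝ :=
  Matrix.reindex (eqOrder n) (varOrder n)
    (Matrix.of fun i k => fderiv ℝ (fun w : Vars n => net.phi w ξ) u (Pi.single k 1) i)

/-- The reduced power flow Jacobian `φ'_u`. -/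
def reducedJacobian (u : Vars n) (ξ : Params n) : Matrix (Fin n) (Fin n) ℝ :=
  diagonal (net.Aoᵀ *ᵥ busV u ξ)
    + (2 : ℝ) • (diagonal u.pLine * net.A2⁻¹ * diagonal net.r)
    + (2 : ℝ) • (diagonal u.qLine * net.A2⁻¹ * diagonal net.x)
    - diagonal u.ell * net.Ao2ᵀ * (net.A2ᵀ)⁻¹
      * (diagonal net.r ^ 2 + (2 : ℝ) • (diagonal net.r * net.A2⁻¹ * diagonal net.r)
        + diagonal net.x ^ 2 + (2 : ℝ) • (diagonal net.x * net.A2⁻¹ * diagonal net.x))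

/-- The lines on the path that connects the root with bus `i`. -/
def pathLines (i : Fin (n + 1)) : Set (Fin n) :=
  {e | ∃ k : ℕ, (towardsRoot net.parent)^[k] i = e.succ}

/-- Sum of the resistances of the lines that connect the root with bus `i`. -/
def rPath (i : Fin (n + 1)) : ℝ := ∑ e, (net.pathLines i).indicator net.r e

/-- Sum of the reactances of the lines that connect the root with bus `i`. -/
def xPath (i : Fin (n + 1)) : ℝ := ∑ e, (net.pathLines i).indicator net.x e

/-- `v_i - 2 p_ij r_ij - 2 q_ij x_ij - 2 ℓ_ij (r_ij r̄_0i + x_ij x̄_0i)` for the line `(i, j)`,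
`i` the parent of `j`. -/
def diagEntry (u : Vars n) (ξ : Params n) (j : Fin n) : ℝ :=
  busV u ξ (net.parent j) - 2 * u.pLine j * net.r j - 2 * u.qLine j * net.x j
    - 2 * u.ell j * (net.r j * net.rPath (net.parent j) + net.x j * net.xPath (net.parent j))

/-- The determinant approximation. -/
def detApprox (u : Vars n) (ξ : Params n) : ℝ := ∏ j, net.diagEntry u ξ j

/-- The power flow solutions `(u, ξ)` with slack voltage `1`, parameters in `D`, and nonsingular
power flow Jacobian. -/
def regularSolutions (D : Set (Params n)) : Set (Vars n × Params n) :=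
  {s | net.phi s.1 s.2 = 0 ∧ s.2.vSlack = 1 ∧ s.2 ∈ D ∧ (net.jacobian s.1 s.2).det ≠ 0}

/-- The voltage stability region of a network whose parameters range over `D`: the connected region
around the flat voltage solution, among the power flow solutions, in which the power flow Jacobian
is nonsingular. -/
def voltageStabilityRegion (D : Set (Params n)) : Set (Vars n × Params n) :=
  connectedComponentIn (net.regularSolutions D) (flatVars n, flatParams n)

end RadialNetwork

end

/-!
Ordering the lines by "lies strictly upstream of" gives a `0`-`1` matrix `Q` with
`A₂⁻¹ = -(1 + Q)` and `A₂ᵒᵀ (A₂ᵀ)⁻¹ = -Qᵀ`. Substituting these, the reduced Jacobian becomes the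
diagonal matrix of sending-end voltages minus a matrix that is entrywise nonnegative as soon as the
flows and currents are. It is then a Z-matrix, and a semipositive Z-matrix (a nonsingular M-matrix)
has a positive determinant, which Gaussian elimination bounds by the product of the diagonal.

Semipositivity spreads over the stability region by connectedness. It is an open condition. On
power flow solutions with nonnegative loads and nonsingular Jacobian it is, together with positive
sending-end voltages, equivalent to the closed condition that the currents, the determinant and the
adjugate are nonnegative; nonsingularity of the full Jacobian enters because every kernel vector of
the reduced Jacobian extends to one of the full Jacobian.
-/

theorem subset_of_isPreconnected_of_inter_eq {X : Type*} [TopologicalSpace X] {C U F : Set X}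
    (hC : IsPreconnected C) (hU : IsOpen U) (hF : IsClosed F) (hUF : C ∩ U = C ∩ F)
    (hne : (C ∩ U).Nonempty) : C ⊆ U := by
  have hcover : C ⊆ U ∪ Fᶜ := fun z hz => by
    by_cases hzF : z ∈ F
    · exact .inl (hUF.ge ⟨hz, hzF⟩).2
    · exact .inr hzF
  have hdisj : C ∩ (U ∩ Fᶜ) = ∅ := by
    rw [← Set.inter_assoc, hUF, Set.inter_assoc, Set.inter_compl_self, Set.inter_empty]
  refine (isPreconnected_iff_subset_of_disjoint.1 hC U Fᶜ hU hF.isOpen_compl hcover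
    hdisj).resolve_right fun hCF => ?_
  obtain ⟨z, hz⟩ := hne
  exact hCF hz.1 (hUF.le hz).2

/-! ### Gaussian elimination and semipositive Z-matrices -/

section ZMatrix

variable {K m : Type*}

section Elimination

variable [Field K] {n : ℕ} {M : Matrix (Fin (n + 1)) (Fin (n + 1)) K}

/-- The Schur complement of the entry `M 0 0`, that is, the matrix left over after one step of
Gaussian elimination. It is meaningful only if `M 0 0 ≠ 0`. -/
def eliminateFirst (M : Matrix (Fin (n + 1)) (Fin (n + 1)) K) : Matrix (Fin n) (Fin n) K :=
  of fun i j => M i.succ j.succ - M i.succ 0 / M 0 0 * M 0 j.succ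

theorem det_eq_mul_det_eliminateFirst (hM : M 0 0 ≠ 0) :
    M.det = M 0 0 * (eliminateFirst M).det := by
  let c : Fin (n + 1) → K := fun i => if i = 0 then 0 else M i 0 / M 0 0
  let B : Matrix (Fin (n + 1)) (Fin (n + 1)) K := of fun i j => M i j - c i * M 0 j
  have det_M : M.det = B.det :=
    det_eq_of_forall_row_eq_smul_add_const c 0 (if_pos rfl) fun i j => by simp [B, c]
  have B_succ_zero (i : Fin n) : B i.succ 0 = 0 := by simp [B, c, hM]
  have B_submatrix : B.submatrix Fin.succ Fin.succ = eliminateFirst M := by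
    ext i j
    simp [B, c, eliminateFirst]
  have B_zero_zero : B 0 0 = M 0 0 := by simp [B, c]
  rw [det_M, det_succ_column_zero, Fin.sum_univ_succ]
  simp [B_succ_zero, B_submatrix, B_zero_zero]

theorem eliminateFirst_mulVec (hM : M 0 0 ≠ 0) (x : Fin (n + 1) → K) (i : Fin n) :
    (eliminateFirst M *ᵥ (x ∘ Fin.succ)) i =
      (M *ᵥ x) i.succ - M i.succ 0 / M 0 0 * (M *ᵥ x) 0 := by
  simp only [mulVec, dotProduct, Fin.sum_univ_succ, eliminateFirst, of_apply, Function.comp_apply,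
    sub_mul, Finset.sum_sub_distrib, mul_assoc, ← Finset.mul_sum]
  field_simp
  ring

end Elimination

/-- A Z-matrix: all off-diagonal entries are nonpositive. -/
def IsZMatrix [Zero K] [LE K] (M : Matrix m m K) : Prop := ∀ i j, i ≠ j → M i j ≤ 0

/-- A semipositive matrix: it maps some positive vector to a positive vector. The semipositive
Z-matrices are the nonsingular M-matrices. -/
def IsSemipositive [NonUnitalNonAssocSemiring K] [LT K] [Fintype m] (M : Matrix m m K) : Prop :=
  ∃ x : m → K, (∀ i, 0 < x i) ∧ ∀ i, 0 < (M *ᵥ x) i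

theorem isSemipositive_one [Semiring K] [PartialOrder K] [IsOrderedRing K] [Nontrivial K]
    [Fintype m] [DecidableEq m] : IsSemipositive (1 : Matrix m m K) :=
  ⟨1, fun _ => zero_lt_one, fun _ => by simp⟩

theorem IsSemipositive.submatrix_equiv {m' : Type*} [NonUnitalNonAssocSemiring K] [LT K]
    [Fintype m] [Fintype m'] {M : Matrix m m K} (hM : IsSemipositive M) (e : m' ≃ m) :
    IsSemipositive (M.submatrix e e) := by
  obtain ⟨x, hx, hMx⟩ := hM
  refine ⟨x ∘ e, fun i => hx (e i), fun i => ?_⟩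
  rw [submatrix_mulVec_equiv, Function.comp_assoc, e.self_comp_symm, Function.comp_id]
  exact hMx (e i)

theorem isOpen_isSemipositive [NonUnitalNonAssocSemiring K] [LinearOrder K] [TopologicalSpace K]
    [OrderClosedTopology K] [ContinuousAdd K] [ContinuousMul K] [Fintype m] :
    IsOpen {M : Matrix m m K | IsSemipositive M} := by
  have hunion : {M : Matrix m m K | IsSemipositive M} =
      ⋃ (x : m → K) (_ : ∀ i, 0 < x i), ⋂ i, {M | 0 < (M *ᵥ x) i} := by
    ext M
    simp [IsSemipositive]
  rw [hunion]
  refine isOpen_biUnion fun x _ => isOpen_iInter_of_finite fun i => ?_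
  exact isOpen_lt continuous_const
    ((continuous_apply i).comp (continuous_id.matrix_mulVec continuous_const))

namespace IsZMatrix

variable [Field K] [LinearOrder K] [IsStrictOrderedRing K]

theorem eliminateFirst_le {n : ℕ} {M : Matrix (Fin (n + 1)) (Fin (n + 1)) K} (hM : IsZMatrix M)
    (hpivot : 0 ≤ M 0 0) (i j : Fin n) : eliminateFirst M i j ≤ M i.succ j.succ :=
  sub_le_self _ <| mul_nonneg_of_nonpos_of_nonpos
    (div_nonpos_of_nonpos_of_nonneg (hM _ _ i.succ_ne_zero) hpivot) (hM _ _ j.succ_ne_zero.symm)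

theorem isZMatrix_eliminateFirst {n : ℕ} {M : Matrix (Fin (n + 1)) (Fin (n + 1)) K}
    (hM : IsZMatrix M) (hpivot : 0 ≤ M 0 0) : IsZMatrix (eliminateFirst M) := fun i j hij =>
  (hM.eliminateFirst_le hpivot i j).trans (hM _ _ (Fin.succ_injective _ |>.ne hij))

variable [Fintype m] {M : Matrix m m K}

theorem diag_mul_pos (hM : IsZMatrix M) {x : m → K} (hx : 0 ≤ x) {i : m} (hMx : 0 < (M *ᵥ x) i) :
    0 < M i i * x i := by
  classical
  have hoff : ∑ j ∈ Finset.univ.erase i, M i j * x j ≤ 0 := Finset.sum_nonpos fun j hj =>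
    mul_nonpos_of_nonpos_of_nonneg (hM i j (Finset.ne_of_mem_erase hj).symm) (hx j)
  rw [mulVec, dotProduct, ← Finset.add_sum_erase _ _ (Finset.mem_univ i)] at hMx
  linarith

theorem diag_pos (hM : IsZMatrix M) (hpos : IsSemipositive M) (i : m) : 0 < M i i := by
  obtain ⟨x, hx, hMx⟩ := hpos
  exact pos_of_mul_pos_left (hM.diag_mul_pos (fun j => (hx j).le) (hMx i)) (hx i).le

theorem isSemipositive_of_nonneg (hM : IsZMatrix M) {x : m → K} (hx : 0 ≤ x)
    (hMx : ∀ i, 0 < (M *ᵥ x) i) : IsSemipositive M := by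
  refine ⟨x, fun i => (hx i).lt_of_ne fun hxi => ?_, hMx⟩
  have hdiag := hM.diag_mul_pos hx (hMx i)
  rw [← hxi, Pi.zero_apply, mul_zero] at hdiag
  exact hdiag.false

-- Where `y / x` is smallest and negative, `y` minus that multiple of `x` is nonnegative with a zero
-- entry, at which `M` would still take it to a positive value.
theorem nonneg_of_mulVec_nonneg (hM : IsZMatrix M) (hpos : IsSemipositive M) {y : m → K}
    (hy : 0 ≤ M *ᵥ y) : 0 ≤ y := fun i => by
  obtain ⟨x, hx, hMx⟩ := hpos
  obtain ⟨k, -, hk⟩ := Finset.exists_min_image Finset.univ (fun i => y i / x i)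
    ⟨i, Finset.mem_univ i⟩
  by_contra! hyi
  set t := y k / x k
  have ht : t < 0 := (hk i (Finset.mem_univ i)).trans_lt (div_neg_of_neg_of_pos hyi (hx i))
  have hz : 0 ≤ y - t • x := fun j => by
    simpa using (le_div_iff₀ (hx j)).1 (hk j (Finset.mem_univ j))
  have hzk : (y - t • x) k = 0 := by simp [t, (hx k).ne']
  have hMz : 0 < (M *ᵥ (y - t • x)) k := by
    rw [mulVec_sub, mulVec_smul]
    exact sub_pos.2 ((mul_neg_of_neg_of_pos ht (hMx k)).trans_le (hy k))
  have hdiag := hM.diag_mul_pos hz hMz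
  rw [hzk, mul_zero] at hdiag
  exact hdiag.false

theorem isSemipositive_eliminateFirst {n : ℕ} {M : Matrix (Fin (n + 1)) (Fin (n + 1)) K}
    (hM : IsZMatrix M) (hpos : IsSemipositive M) :
    IsSemipositive (eliminateFirst M) := by
  have hpivot := hM.diag_pos hpos 0
  obtain ⟨x, hx, hMx⟩ := hpos
  refine ⟨x ∘ Fin.succ, fun i => hx i.succ, fun i => ?_⟩
  rw [eliminateFirst_mulVec hpivot.ne', sub_pos]
  exact (mul_nonpos_of_nonpos_of_nonneg
    (div_nonpos_of_nonpos_of_nonneg (hM _ _ i.succ_ne_zero) hpivot.le) (hMx 0).le).trans_lt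
    (hMx i.succ)

theorem det_pos_and_det_le_prod_diag_fin {n : ℕ} {M : Matrix (Fin n) (Fin n) K} (hM : IsZMatrix M)
    (hpos : IsSemipositive M) : 0 < M.det ∧ M.det ≤ ∏ i, M i i := by
  induction n with
  | zero => simp
  | succ n ih =>
    have hpivot := hM.diag_pos hpos 0
    have hS := hM.isZMatrix_eliminateFirst hpivot.le
    have hSpos := hM.isSemipositive_eliminateFirst hpos
    obtain ⟨hdet_pos, hdet_le⟩ := ih hS hSpos
    rw [det_eq_mul_det_eliminateFirst hpivot.ne', Fin.prod_univ_succ]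
    refine ⟨mul_pos hpivot hdet_pos, mul_le_mul_of_nonneg_left (hdet_le.trans ?_) hpivot.le⟩
    exact Finset.prod_le_prod (fun i _ => (hS.diag_pos hSpos i).le) fun i _ =>
      hM.eliminateFirst_le hpivot.le i i

variable [DecidableEq m]

theorem det_pos_and_det_le_prod_diag (hM : IsZMatrix M) (hpos : IsSemipositive M) :
    0 < M.det ∧ M.det ≤ ∏ i, M i i := by
  let e := (Fintype.equivFin m).symm
  have hMe : IsZMatrix (M.submatrix e e) := fun i j hij => hM _ _ (e.injective.ne hij)
  have h := hMe.det_pos_and_det_le_prod_diag_fin (hpos.submatrix_equiv e)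
  simpa only [det_submatrix_equiv_self, submatrix_apply, e.prod_comp fun i => M i i] using h

theorem adjugate_nonneg (hM : IsZMatrix M) (hpos : IsSemipositive M) (i j : m) :
    0 ≤ M.adjugate i j := by
  have hdet := (hM.det_pos_and_det_le_prod_diag hpos).1.le
  refine hM.nonneg_of_mulVec_nonneg hpos (y := fun k => M.adjugate k j) (fun k => ?_) i
  change 0 ≤ (M * M.adjugate) k j
  rw [mul_adjugate, Matrix.smul_apply, one_apply]
  split_ifs <;> simp [hdet]

theorem isSemipositive_of_adjugate_nonneg (hM : IsZMatrix M) (hdet : 0 < M.det)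
    (hadj : ∀ i j, 0 ≤ M.adjugate i j) : IsSemipositive M := by
  refine hM.isSemipositive_of_nonneg (x := M.adjugate *ᵥ 1)
    (fun i => Finset.sum_nonneg fun j _ => mul_nonneg (hadj i j) zero_le_one) fun i => ?_
  rw [mulVec_mulVec, mul_adjugate, smul_mulVec, one_mulVec]
  simpa using hdet

theorem isSemipositive_iff_of_det_ne_zero (hM : IsZMatrix M) (hdet : M.det ≠ 0) :
    IsSemipositive M ↔ 0 ≤ M.det ∧ ∀ i j, 0 ≤ M.adjugate i j :=
  ⟨fun hpos => ⟨(hM.det_pos_and_det_le_prod_diag hpos).1.le, hM.adjugate_nonneg hpos⟩,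
    fun h => hM.isSemipositive_of_adjugate_nonneg (h.1.lt_of_ne' hdet) h.2⟩

end IsZMatrix

end ZMatrix

namespace RadialNetwork

variable {n : ℕ} (net : RadialNetwork n)

/-! ### Paths and the inverse of the incidence matrix -/

section Tree

theorem notMem_pathLines_zero (e : Fin n) : e ∉ net.pathLines 0 := by
  rintro ⟨k, hk⟩
  rw [Function.iterate_fixed rfl] at hk
  exact e.succ_ne_zero hk.symm

-- Otherwise bus `j.succ` would be periodic under `towardsRoot` and never reach the root.
theorem notMem_pathLines_parent (j : Fin n) : j ∉ net.pathLines (net.parent j) := by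
  rintro ⟨k, hk⟩
  have hperiod : (towardsRoot net.parent)^[k + 1] j.succ = j.succ := hk
  obtain ⟨l, hl⟩ := net.reaches_root j.succ
  have hiter : (towardsRoot net.parent)^[(k + 1) * l] j.succ = j.succ := by
    rw [Function.iterate_mul, Function.iterate_fixed hperiod]
  rw [add_mul, one_mul, Function.iterate_add_apply, hl, Function.iterate_fixed rfl] at hiter
  exact j.succ_ne_zero hiter.symm

theorem mem_pathLines_succ {e j : Fin n} :
    e ∈ net.pathLines j.succ ↔ e = j ∨ e ∈ net.pathLines (net.parent j) := by
  constructor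
  · rintro ⟨_ | k, hk⟩
    · exact .inl (Fin.succ_injective _ hk).symm
    · exact .inr ⟨k, hk⟩
  · rintro (rfl | ⟨k, hk⟩)
    · exact ⟨0, rfl⟩
    · exact ⟨k + 1, hk⟩

/-- The `0`-`1` matrix whose entry at `(e, j)` tells whether line `e` lies strictly upstream of
line `j`, that is, on the path from the root to the sending end of `j`. Adding the identity includes
`j` itself. -/
noncomputable def upstream : Matrix (Fin n) (Fin n) ℝ :=
  of fun e j => (net.pathLines (net.parent j)).indicator 1 e

theorem upstream_nonneg (e j : Fin n) : 0 ≤ net.upstream e j :=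
  Set.indicator_nonneg (fun _ _ => zero_le_one) _

theorem upstream_self (j : Fin n) : net.upstream j j = 0 :=
  Set.indicator_of_notMem (net.notMem_pathLines_parent j) _

theorem upstream_mul_self (e j : Fin n) :
    net.upstream e j * net.upstream e j = net.upstream e j := by
  classical
  simp [upstream, Set.indicator_apply]

theorem one_add_upstream_nonneg (e j : Fin n) : 0 ≤ (1 + net.upstream) e j := by
  rw [Matrix.add_apply, one_apply]
  exact add_nonneg (by split_ifs <;> simp) (net.upstream_nonneg e j)

theorem one_add_upstream_apply (e j : Fin n) :
    (1 + net.upstream) e j = (net.pathLines j.succ).indicator 1 e := by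
  classical
  rcases eq_or_ne e j with rfl | hej
  · simp [upstream_self, net.mem_pathLines_succ]
  · simp [upstream, Set.indicator_apply, net.mem_pathLines_succ, hej]

theorem sum_indicator_pathLines_parent (y : Fin n → ℝ) (j : Fin n) :
    ∑ e, (net.pathLines (net.parent j)).indicator y e = ∑ e, net.upstream e j * y e := by
  classical
  simp [upstream, Set.indicator_apply]

theorem one_add_upstream_mul_Ao2 : (1 + net.upstream) * net.Ao2 = net.upstream := by
  ext e j
  simp only [mul_apply, one_add_upstream_apply, Ao2, Ao, submatrix_apply, of_apply, id]
  rcases Fin.eq_zero_or_eq_succ (net.parent j) with hroot | ⟨k, hk⟩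
  · simp [upstream, hroot, Fin.succ_ne_zero, notMem_pathLines_zero]
  · simp [upstream, hk]

theorem one_add_upstream_mul_one_sub_Ao2 : (1 + net.upstream) * (1 - net.Ao2) = 1 := by
  rw [mul_sub, mul_one, one_add_upstream_mul_Ao2, add_sub_cancel_right]

theorem sub_Ao2_mulVec_eq_iff {f g : Fin n → ℝ} :
    f - net.Ao2 *ᵥ f = g ↔ f = (1 + net.upstream) *ᵥ g := by
  have hinv := net.one_add_upstream_mul_one_sub_Ao2
  have hsub : f - net.Ao2 *ᵥ f = (1 - net.Ao2) *ᵥ f := by rw [sub_mulVec, one_mulVec]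
  rw [hsub]
  constructor
  · rintro rfl
    rw [mulVec_mulVec, hinv, one_mulVec]
  · rintro rfl
    rw [mulVec_mulVec, mul_eq_one_comm.1 hinv, one_mulVec]

theorem A2_eq_Ao2_sub_one : net.A2 = net.Ao2 - 1 := by
  ext i j
  simp [A2, A, Ao2, Ai, one_apply]

theorem A2_inv : net.A2⁻¹ = -(1 + net.upstream) := by
  refine inv_eq_left_inv ?_
  rw [A2_eq_Ao2_sub_one, neg_mul, ← mul_neg, neg_sub, one_add_upstream_mul_one_sub_Ao2]

theorem Ao2_transpose_mul_A2_transpose_inv : net.Ao2ᵀ * (net.A2ᵀ)⁻¹ = -net.upstreamᵀ := by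
  rw [← transpose_nonsing_inv, A2_inv, ← transpose_mul, neg_mul, one_add_upstream_mul_Ao2,
    transpose_neg]

end Tree

section Incidence

theorem Ao_transpose_mulVec (v : Fin (n + 1) → ℝ) : net.Aoᵀ *ᵥ v = v ∘ net.parent := by
  ext j
  simp [mulVec, dotProduct, Ao]

theorem Ai_transpose_mulVec (v : Fin (n + 1) → ℝ) : net.Aiᵀ *ᵥ v = v ∘ Fin.succ := by
  ext j
  simp [mulVec, dotProduct, Ai]

theorem Ao2_transpose_mulVec (v : Fin n → ℝ) :
    net.Ao2ᵀ *ᵥ v = (Fin.cons 0 v : Fin (n + 1) → ℝ) ∘ net.parent := by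
  rw [← Ao_transpose_mulVec]
  ext j
  simp [mulVec, dotProduct, Fin.sum_univ_succ, Ao2]

theorem Ai_mulVec (f : Fin n → ℝ) : net.Ai *ᵥ f = Fin.cons 0 f := by
  ext i
  refine Fin.cases ?_ (fun j => ?_) i <;> simp [mulVec, dotProduct, Ai, (Fin.succ_ne_zero _).symm]

theorem Ao_mulVec_succ (f : Fin n → ℝ) (j : Fin n) : (net.Ao *ᵥ f) j.succ = (net.Ao2 *ᵥ f) j := rfl

end Incidence

/-! ### The reduced Jacobian as a Z-matrix -/

section ReducedJacobian

/-- If the current on the lines changes by `w` and the flows `f` follow so as to keep the demands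
fixed, then `lineDrop y *ᵥ w` is the contribution `2 [y] f - [y]² w` of the impedance component `y`
to the change in voltage drop across the lines. -/
noncomputable def lineDrop (y : Fin n → ℝ) : Matrix (Fin n) (Fin n) ℝ :=
  diagonal y * (1 + (2 : ℝ) • net.upstream) * diagonal y

theorem lineDrop_apply (y : Fin n → ℝ) (i j : Fin n) :
    net.lineDrop y i j = y i * ((if i = j then 1 else 0) + 2 * net.upstream i j) * y j := by
  simp [lineDrop, one_apply]

theorem lineDrop_eq_sub (y : Fin n → ℝ) : net.lineDrop y =
    (2 : ℝ) • (diagonal y * (1 + net.upstream) * diagonal y) - diagonal y ^ 2 := by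
  simp only [lineDrop, mul_add, add_mul, mul_one, smul_add, sq, two_smul]
  abel

theorem lineDrop_nonneg {y : Fin n → ℝ} (hy : 0 ≤ y) (i j : Fin n) : 0 ≤ net.lineDrop y i j := by
  have hcoeff : (0 : ℝ) ≤ (if i = j then 1 else 0) + 2 * net.upstream i j :=
    add_nonneg (by split_ifs <;> simp) (mul_nonneg zero_le_two (net.upstream_nonneg i j))
  rw [lineDrop_apply]
  exact mul_nonneg (mul_nonneg (hy i) hcoeff) (hy j)

theorem upstream_transpose_mul_lineDrop_nonneg {y : Fin n → ℝ} (hy : 0 ≤ y) (i j : Fin n) :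
    0 ≤ (net.upstreamᵀ * net.lineDrop y) i j := by
  rw [mul_apply]
  exact Finset.sum_nonneg fun k _ =>
    mul_nonneg (net.upstream_nonneg k i) (net.lineDrop_nonneg hy k j)

theorem upstream_transpose_mul_lineDrop_diag (y : Fin n → ℝ) (j : Fin n) :
    (net.upstreamᵀ * net.lineDrop y) j j =
      2 * y j * ∑ e, (net.pathLines (net.parent j)).indicator y e := by
  rw [mul_apply, sum_indicator_pathLines_parent, Finset.mul_sum]
  refine Finset.sum_congr rfl fun k _ => ?_
  rw [transpose_apply, lineDrop_apply]
  rcases eq_or_ne k j with rfl | hkj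
  · simp [upstream_self]
  · rw [if_neg hkj]
    linear_combination 2 * y k * y j * net.upstream_mul_self k j

/-- What the line flows and currents subtract from the diagonal matrix of sending-end voltages in
the reduced Jacobian. -/
noncomputable def flowLoading (u : Vars n) : Matrix (Fin n) (Fin n) ℝ :=
  (2 : ℝ) • (diagonal u.pLine * (1 + net.upstream) * diagonal net.r)
    + (2 : ℝ) • (diagonal u.qLine * (1 + net.upstream) * diagonal net.x)
    + diagonal u.ell * (net.upstreamᵀ * net.lineDrop net.r + net.upstreamᵀ * net.lineDrop net.x)

theorem reducedJacobian_eq_sub_flowLoading (u : Vars n) (ξ : Params n) :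
    net.reducedJacobian u ξ = diagonal (busV u ξ ∘ net.parent) - net.flowLoading u := by
  rw [reducedJacobian, Matrix.mul_assoc (diagonal u.ell), Ao2_transpose_mul_A2_transpose_inv,
    A2_inv, Ao_transpose_mulVec, flowLoading, lineDrop_eq_sub, lineDrop_eq_sub]
  simp only [mul_neg, neg_mul, smul_neg, mul_add, mul_sub, mul_assoc]
  abel

theorem flowLoading_apply (u : Vars n) (i j : Fin n) : net.flowLoading u i j =
    2 * (u.pLine i * (1 + net.upstream) i j * net.r j)
      + 2 * (u.qLine i * (1 + net.upstream) i j * net.x j)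
      + u.ell i * ((net.upstreamᵀ * net.lineDrop net.r) i j
        + (net.upstreamᵀ * net.lineDrop net.x) i j) := by
  simp only [flowLoading, Matrix.add_apply, Matrix.smul_apply, mul_diagonal, diagonal_mul,
    smul_eq_mul]

theorem reducedJacobian_diag (u : Vars n) (ξ : Params n) (j : Fin n) :
    net.reducedJacobian u ξ j j = net.diagEntry u ξ j := by
  rw [reducedJacobian_eq_sub_flowLoading, Matrix.sub_apply, diagonal_apply_eq, flowLoading_apply,
    Matrix.add_apply, one_apply_eq, upstream_self, upstream_transpose_mul_lineDrop_diag,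
    upstream_transpose_mul_lineDrop_diag, diagEntry, rPath, xPath, Function.comp_apply]
  ring

variable {u : Vars n}

theorem flowLoading_nonneg (hp : 0 ≤ u.pLine) (hq : 0 ≤ u.qLine) (hl : 0 ≤ u.ell) (i j : Fin n) :
    0 ≤ net.flowLoading u i j := by
  have hr := net.upstream_transpose_mul_lineDrop_nonneg net.r_nonneg i j
  have hx := net.upstream_transpose_mul_lineDrop_nonneg net.x_nonneg i j
  have hP := net.one_add_upstream_nonneg i j
  have hrj := net.r_nonneg j
  have hxj := net.x_nonneg j
  have hpi := hp i
  have hqi := hq i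
  have hli := hl i
  rw [Pi.zero_apply] at hpi hqi hli
  rw [flowLoading_apply]
  positivity

theorem isZMatrix_reducedJacobian (ξ : Params n) (hp : 0 ≤ u.pLine) (hq : 0 ≤ u.qLine)
    (hl : 0 ≤ u.ell) : IsZMatrix (net.reducedJacobian u ξ) := fun i j hij => by
  rw [reducedJacobian_eq_sub_flowLoading, Matrix.sub_apply, diagonal_apply_ne _ hij, zero_sub]
  exact neg_nonpos.2 (net.flowLoading_nonneg hp hq hl i j)

theorem reducedJacobian_diag_le (ξ : Params n) (hp : 0 ≤ u.pLine) (hq : 0 ≤ u.qLine)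
    (hl : 0 ≤ u.ell) (j : Fin n) : net.reducedJacobian u ξ j j ≤ busV u ξ (net.parent j) := by
  rw [reducedJacobian_eq_sub_flowLoading, Matrix.sub_apply, diagonal_apply_eq]
  exact sub_le_self _ (net.flowLoading_nonneg hp hq hl j j)

theorem busV_flat : busV (flatVars n) (flatParams n) = 1 :=
  funext fun i => Fin.cases rfl (fun _ => rfl) i

theorem reducedJacobian_flat : net.reducedJacobian (flatVars n) (flatParams n) = 1 := by
  have hp : (flatVars n).pLine = 0 := rfl
  have hq : (flatVars n).qLine = 0 := rfl
  have hl : (flatVars n).ell = 0 := rfl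
  rw [reducedJacobian_eq_sub_flowLoading, flowLoading, busV_flat, hp, hq, hl]
  simp

end ReducedJacobian

/-! ### Power flow solutions with nonnegative loads -/

section Solutions

variable {net}

theorem balance_eq_zero_iff {f loss demand : Fin n → ℝ} {slack : ℝ} :
    net.Ai *ᵥ (f - loss) - net.Ao *ᵥ f - Fin.cons slack demand = 0 ↔
      slack = -(net.Ao *ᵥ f) 0 ∧ f = (1 + net.upstream) *ᵥ (demand + loss) := by
  rw [← sub_Ao2_mulVec_eq_iff, Ai_mulVec, funext_iff, Fin.forall_fin_succ, funext_iff]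
  refine and_congr ?_ (forall_congr' fun j => ?_)
  · simp only [Pi.sub_apply, Fin.cons_zero, Pi.zero_apply]
    constructor <;> intro h <;> linarith
  · simp only [Pi.sub_apply, Pi.add_apply, Fin.cons_succ, Pi.zero_apply, Ao_mulVec_succ]
    constructor <;> intro h <;> linarith

variable {u : Vars n} {ξ : Params n}

theorem pLine_eq_of_phi_eq_zero (hphi : net.phi u ξ = 0) :
    u.pLine = (1 + net.upstream) *ᵥ (ξ.pPQ + diagonal net.r *ᵥ u.ell) :=
  (balance_eq_zero_iff.1 <| funext fun i => congrFun hphi (.inl i)).2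

theorem qLine_eq_of_phi_eq_zero (hphi : net.phi u ξ = 0) :
    u.qLine = (1 + net.upstream) *ᵥ (ξ.qPQ + diagonal net.x *ᵥ u.ell) :=
  (balance_eq_zero_iff.1 <| funext fun i => congrFun hphi (.inr (.inl i))).2

theorem busV_mul_ell_of_phi_eq_zero (hphi : net.phi u ξ = 0) (j : Fin n) :
    busV u ξ (net.parent j) * u.ell j = u.pLine j * u.pLine j + u.qLine j * u.qLine j := by
  have hcurrent := congrFun hphi (.inr (.inr (.inr j)))
  simp only [phi, Sum.elim_inr, Pi.sub_apply, Pi.add_apply, mulVec_diagonal,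
    Ao_transpose_mulVec, Function.comp_apply, Pi.zero_apply] at hcurrent
  exact (sub_eq_zero.1 hcurrent).symm

theorem ell_nonneg (hphi : net.phi u ξ = 0) (hv : ∀ j, 0 < busV u ξ (net.parent j)) :
    0 ≤ u.ell := fun j => by
  refine nonneg_of_mul_nonneg_right ?_ (hv j)
  rw [busV_mul_ell_of_phi_eq_zero hphi]
  exact add_nonneg (mul_self_nonneg _) (mul_self_nonneg _)

theorem one_add_upstream_mulVec_nonneg {demand y l : Fin n → ℝ} (hdemand : 0 ≤ demand) (hy : 0 ≤ y)
    (hl : 0 ≤ l) : 0 ≤ (1 + net.upstream) *ᵥ (demand + diagonal y *ᵥ l) := fun i => by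
  refine dotProduct_nonneg_of_nonneg (net.one_add_upstream_nonneg i)
    (add_nonneg hdemand fun j => ?_)
  rw [mulVec_diagonal]
  exact mul_nonneg (hy j) (hl j)

theorem pLine_nonneg (hphi : net.phi u ξ = 0) (hp : 0 ≤ ξ.pPQ) (hl : 0 ≤ u.ell) : 0 ≤ u.pLine :=
  (pLine_eq_of_phi_eq_zero hphi).ge.trans' (one_add_upstream_mulVec_nonneg hp net.r_nonneg hl)

theorem qLine_nonneg (hphi : net.phi u ξ = 0) (hq : 0 ≤ ξ.qPQ) (hl : 0 ≤ u.ell) : 0 ≤ u.qLine :=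
  (qLine_eq_of_phi_eq_zero hphi).ge.trans' (one_add_upstream_mulVec_nonneg hq net.x_nonneg hl)

end Solutions

/-! ### Nonsingularity of the reduced Jacobian -/

section Jacobian

variable (u d : Vars n) (ξ : Params n)

/-- The derivative of `phi` with respect to the variables, in direction `d`. Since the parameters
are held fixed, the bus vectors of `d` are formed with parameters `0`. -/
noncomputable def phiDeriv : EqIdx n → ℝ :=
  Sum.elim
    (net.Ai *ᵥ (d.pLine - diagonal net.r *ᵥ d.ell) - net.Ao *ᵥ d.pLine - busP d 0)
    (Sum.elim
      (net.Ai *ᵥ (d.qLine - diagonal net.x *ᵥ d.ell) - net.Ao *ᵥ d.qLine - busQ d 0)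
      (Sum.elim
        (net.Aoᵀ *ᵥ busV d 0
          - (2 : ℝ) • (diagonal net.r *ᵥ d.pLine + diagonal net.x *ᵥ d.qLine)
          + (diagonal net.r ^ 2 + diagonal net.x ^ 2) *ᵥ d.ell - net.Aiᵀ *ᵥ busV d 0)
        ((2 : ℝ) • (diagonal u.pLine *ᵥ d.pLine + diagonal u.qLine *ᵥ d.qLine)
          - diagonal (net.Aoᵀ *ᵥ busV u ξ) *ᵥ d.ell - diagonal u.ell *ᵥ (net.Aoᵀ *ᵥ busV d 0))))

theorem busV_add_smul (t : ℝ) : busV (u + t • d) ξ = busV u ξ + t • busV d 0 := by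
  ext i
  refine Fin.cases ?_ (fun j => ?_) i <;> simp [busV, Vars.vPQ, Params.vSlack]

theorem busP_add_smul (t : ℝ) : busP (u + t • d) ξ = busP u ξ + t • busP d 0 := by
  ext i
  refine Fin.cases ?_ (fun j => ?_) i <;> simp [busP, Vars.pSlack, Params.pPQ]

theorem busQ_add_smul (t : ℝ) : busQ (u + t • d) ξ = busQ u ξ + t • busQ d 0 := by
  ext i
  refine Fin.cases ?_ (fun j => ?_) i <;> simp [busQ, Vars.qSlack, Params.qPQ]

theorem exists_phi_add_smul_eq : ∃ c : EqIdx n → ℝ, ∀ t : ℝ,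
    net.phi (u + t • d) ξ = net.phi u ξ + t • net.phiDeriv u d ξ + t ^ 2 • c := by
  refine ⟨Sum.elim 0 (Sum.elim 0 (Sum.elim 0 (diagonal d.pLine *ᵥ d.pLine
    + diagonal d.qLine *ᵥ d.qLine - diagonal (net.Aoᵀ *ᵥ busV d 0) *ᵥ d.ell))), fun t => ?_⟩
  have hp : (u + t • d).pLine = u.pLine + t • d.pLine := rfl
  have hq : (u + t • d).qLine = u.qLine + t • d.qLine := rfl
  have hl : (u + t • d).ell = u.ell + t • d.ell := rfl
  funext i
  rcases i with i | i | i | i <;>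
    simp only [phi, phiDeriv, hp, hq, hl, busV_add_smul, busP_add_smul, busQ_add_smul, mulVec_add,
      mulVec_sub, mulVec_smul, Sum.elim_inl, Sum.elim_inr, Pi.add_apply, Pi.sub_apply,
      Pi.smul_apply, Pi.zero_apply, smul_eq_mul, mulVec_diagonal] <;> ring

theorem differentiable_busV : Differentiable ℝ fun w : Vars n => busV w ξ := by
  unfold busV Vars.vPQ
  fun_prop

theorem differentiable_busP : Differentiable ℝ fun w : Vars n => busP w ξ := by
  unfold busP Vars.pSlack
  fun_prop

theorem differentiable_busQ : Differentiable ℝ fun w : Vars n => busQ w ξ := by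
  unfold busQ Vars.qSlack
  fun_prop

theorem differentiable_phi : Differentiable ℝ fun w : Vars n => net.phi w ξ := by
  have hV := differentiable_pi.1 (differentiable_busV ξ)
  have hP := differentiable_pi.1 (differentiable_busP ξ)
  have hQ := differentiable_pi.1 (differentiable_busQ ξ)
  refine differentiable_pi.2 fun i => ?_
  rcases i with i | i | i | i <;>
    simp only [phi, Sum.elim_inl, Sum.elim_inr, Pi.add_apply, Pi.sub_apply, Pi.smul_apply,
      mulVec_diagonal, Ao_transpose_mulVec] <;>
    simp only [mulVec, dotProduct, Pi.sub_apply, Function.comp_apply, Vars.pLine, Vars.qLine,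
      Vars.ell] <;> fun_prop

theorem fderiv_phi_apply : fderiv ℝ (fun w : Vars n => net.phi w ξ) u d = net.phiDeriv u d ξ := by
  rw [← (net.differentiable_phi ξ u).lineDeriv_eq_fderiv]
  refine HasLineDerivAt.lineDeriv ?_
  obtain ⟨c, hc⟩ := net.exists_phi_add_smul_eq u d ξ
  have hlin : HasDerivAt (fun t : ℝ => net.phi u ξ + t • net.phiDeriv u d ξ)
      (net.phiDeriv u d ξ) 0 := by
    simpa using ((hasDerivAt_id (0 : ℝ)).smul_const (net.phiDeriv u d ξ)).const_add (net.phi u ξ)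
  have hsq : HasDerivAt (fun t : ℝ => t ^ 2 • c) 0 0 := by
    simpa using (hasDerivAt_pow 2 (0 : ℝ)).smul_const c
  simpa only [HasLineDerivAt, hc, add_zero] using hlin.fun_add hsq

theorem jacobian_mulVec : net.jacobian u ξ *ᵥ (d ∘ (varOrder n).symm) =
    net.phiDeriv u d ξ ∘ (eqOrder n).symm := by
  have hfderiv : (of fun i k => fderiv ℝ (fun w : Vars n => net.phi w ξ) u (Pi.single k 1) i) *ᵥ d
      = net.phiDeriv u d ξ := by
    rw [← fderiv_phi_apply]
    funext i
    conv_rhs => rw [pi_eq_sum_univ' d]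
    simp [mulVec, dotProduct, mul_comm]
  rw [jacobian, reindex_apply, submatrix_mulVec_equiv, Equiv.symm_symm, Function.comp_assoc,
    Equiv.symm_comp_self, Function.comp_id, hfderiv]

variable (w : Fin n → ℝ)

/-- The variation of all the variables that is forced by a variation `w` of the currents once the
demands at buses `1, …, n` are fixed and all equations but the current equation are to hold to first
order. -/
noncomputable def inducedVariation : Vars n :=
  let dp := (1 + net.upstream) *ᵥ (diagonal net.r *ᵥ w)
  let dq := (1 + net.upstream) *ᵥ (diagonal net.x *ᵥ w)
  let dv := -((1 + net.upstream)ᵀ *ᵥ ((net.lineDrop net.r + net.lineDrop net.x) *ᵥ w))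
  Sum.elim dp (Sum.elim dq (Sum.elim w (Sum.elim dv
    (Sum.elim (fun _ => -(net.Ao *ᵥ dp) 0) (fun _ => -(net.Ao *ᵥ dq) 0)))))

theorem pLine_inducedVariation :
    (net.inducedVariation w).pLine = (1 + net.upstream) *ᵥ (diagonal net.r *ᵥ w) := rfl

theorem qLine_inducedVariation :
    (net.inducedVariation w).qLine = (1 + net.upstream) *ᵥ (diagonal net.x *ᵥ w) := rfl

theorem ell_inducedVariation : (net.inducedVariation w).ell = w := rfl

theorem Ai_transpose_mulVec_busV_inducedVariation :
    net.Aiᵀ *ᵥ busV (net.inducedVariation w) 0 =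
      -((1 + net.upstream)ᵀ *ᵥ ((net.lineDrop net.r + net.lineDrop net.x) *ᵥ w)) := by
  rw [Ai_transpose_mulVec]
  rfl

theorem Ao_transpose_mulVec_busV_inducedVariation :
    net.Aoᵀ *ᵥ busV (net.inducedVariation w) 0 =
      -(net.upstreamᵀ *ᵥ ((net.lineDrop net.r + net.lineDrop net.x) *ᵥ w)) := by
  have hAo2 : net.Aoᵀ *ᵥ busV (net.inducedVariation w) 0 =
      net.Ao2ᵀ *ᵥ (net.inducedVariation w).vPQ := by
    rw [Ao_transpose_mulVec, Ao2_transpose_mulVec]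
    rfl
  have hvPQ : (net.inducedVariation w).vPQ =
      -((1 + net.upstream)ᵀ *ᵥ ((net.lineDrop net.r + net.lineDrop net.x) *ᵥ w)) := rfl
  rw [hAo2, hvPQ, mulVec_neg, mulVec_mulVec, ← transpose_mul, one_add_upstream_mul_Ao2]

theorem phiDeriv_inducedVariation_voltage :
    net.Aoᵀ *ᵥ busV (net.inducedVariation w) 0
      - (2 : ℝ) • (diagonal net.r *ᵥ (net.inducedVariation w).pLine
        + diagonal net.x *ᵥ (net.inducedVariation w).qLine)
      + (diagonal net.r ^ 2 + diagonal net.x ^ 2) *ᵥ (net.inducedVariation w).ell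
      - net.Aiᵀ *ᵥ busV (net.inducedVariation w) 0 = 0 := by
  rw [Ao_transpose_mulVec_busV_inducedVariation, Ai_transpose_mulVec_busV_inducedVariation,
    pLine_inducedVariation, qLine_inducedVariation, ell_inducedVariation, transpose_add,
    transpose_one, add_mulVec 1, one_mulVec, lineDrop_eq_sub, lineDrop_eq_sub]
  simp only [add_mulVec, sub_mulVec, smul_mulVec, ← mulVec_mulVec, one_mulVec, smul_add]
  abel

theorem phiDeriv_inducedVariation_current :
    (2 : ℝ) • (diagonal u.pLine *ᵥ (net.inducedVariation w).pLine
        + diagonal u.qLine *ᵥ (net.inducedVariation w).qLine)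
      - diagonal (net.Aoᵀ *ᵥ busV u ξ) *ᵥ (net.inducedVariation w).ell
      - diagonal u.ell *ᵥ (net.Aoᵀ *ᵥ busV (net.inducedVariation w) 0) =
    -(net.reducedJacobian u ξ *ᵥ w) := by
  rw [Ao_transpose_mulVec_busV_inducedVariation, pLine_inducedVariation, qLine_inducedVariation,
    ell_inducedVariation, Ao_transpose_mulVec, reducedJacobian_eq_sub_flowLoading, flowLoading]
  simp only [sub_mulVec, add_mulVec, smul_mulVec, mulVec_add, mulVec_neg, ← mulVec_mulVec, smul_add]
  abel

theorem phiDeriv_inducedVariation : net.phiDeriv u (net.inducedVariation w) ξ =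
    (Sum.elim 0 (Sum.elim 0 (Sum.elim 0 (-(net.reducedJacobian u ξ *ᵥ w)))) : EqIdx n → ℝ) := by
  have hactive := (balance_eq_zero_iff (net := net) (f := (net.inducedVariation w).pLine)
    (loss := diagonal net.r *ᵥ w) (demand := 0)).2 ⟨rfl, by rw [zero_add, pLine_inducedVariation]⟩
  have hreactive := (balance_eq_zero_iff (net := net) (f := (net.inducedVariation w).qLine)
    (loss := diagonal net.x *ᵥ w) (demand := 0)).2 ⟨rfl, by rw [zero_add, qLine_inducedVariation]⟩
  rw [phiDeriv, phiDeriv_inducedVariation_voltage, phiDeriv_inducedVariation_current]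
  exact congrArg₂ Sum.elim hactive (congrArg₂ Sum.elim hreactive rfl)

theorem reducedJacobian_det_ne_zero {u : Vars n} {ξ : Params n} (h : (net.jacobian u ξ).det ≠ 0) :
    (net.reducedJacobian u ξ).det ≠ 0 := by
  contrapose! h
  obtain ⟨w, hw, hker⟩ := exists_mulVec_eq_zero_iff.2 h
  refine exists_mulVec_eq_zero_iff.1
    ⟨net.inducedVariation w ∘ (varOrder n).symm, fun hzero => hw ?_, ?_⟩
  · funext j
    simpa [inducedVariation] using congrFun hzero (varOrder n (.inr (.inr (.inl j))))
  · rw [jacobian_mulVec, phiDeriv_inducedVariation, hker, neg_zero]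
    simp only [Sum.elim_zero_zero, Pi.zero_comp]

end Jacobian

/-! ### Propagation over the stability region -/

section Stability

theorem continuous_busV : Continuous fun s : Vars n × Params n => busV s.1 s.2 := by
  unfold busV Vars.vPQ Params.vSlack
  fun_prop

theorem continuous_ell : Continuous fun s : Vars n × Params n => s.1.ell := by
  unfold Vars.ell
  fun_prop

theorem continuous_reducedJacobian :
    Continuous fun s : Vars n × Params n => net.reducedJacobian s.1 s.2 := by
  have hV := continuous_busV (n := n)
  unfold reducedJacobian Vars.pLine Vars.qLine Vars.ell
  fun_prop

/-- The states with positive sending-end voltages and semipositive reduced Jacobian. -/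
def semipositiveStates : Set (Vars n × Params n) :=
  {s | (∀ j, 0 < busV s.1 s.2 (net.parent j)) ∧ IsSemipositive (net.reducedJacobian s.1 s.2)}

/-- The states with nonnegative currents whose reduced Jacobian has nonnegative determinant and
adjugate: a closed counterpart of `semipositiveStates`, with which it agrees on the regular power
flow solutions under nonnegative loads. -/
def nonnegStates : Set (Vars n × Params n) :=
  {s | 0 ≤ s.1.ell ∧ 0 ≤ (net.reducedJacobian s.1 s.2).det ∧
    ∀ i j, 0 ≤ (net.reducedJacobian s.1 s.2).adjugate i j}

theorem isOpen_semipositiveStates : IsOpen net.semipositiveStates := by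
  have hvoltage (j : Fin n) : Continuous fun s : Vars n × Params n => busV s.1 s.2 (net.parent j) :=
    (continuous_apply _).comp continuous_busV
  simp only [semipositiveStates, Set.ofPred_and, Set.ofPred_forall]
  exact (isOpen_iInter_of_finite fun j => isOpen_lt continuous_const (hvoltage j)).inter
    (isOpen_isSemipositive.preimage net.continuous_reducedJacobian)

theorem isClosed_nonnegStates : IsClosed net.nonnegStates := by
  have hJ := net.continuous_reducedJacobian
  simp only [nonnegStates, Set.ofPred_and, Set.ofPred_forall]
  exact (isClosed_le continuous_const continuous_ell).inter <|
    (isClosed_le continuous_const hJ.matrix_det).inter <|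
      isClosed_iInter fun i => isClosed_iInter fun j =>
        isClosed_le continuous_const (hJ.matrix_adjugate.matrix_elem i j)

variable {net} {u : Vars n} {ξ : Params n}

theorem isZMatrix_reducedJacobian_of_loadParams (hphi : net.phi u ξ = 0) (hξ : ξ ∈ loadParams n)
    (hl : 0 ≤ u.ell) : IsZMatrix (net.reducedJacobian u ξ) :=
  net.isZMatrix_reducedJacobian ξ (pLine_nonneg hphi (fun j => (hξ j).1) hl)
    (qLine_nonneg hphi (fun j => (hξ j).2) hl) hl

theorem mem_semipositiveStates_iff_mem_nonnegStates (hphi : net.phi u ξ = 0)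
    (hξ : ξ ∈ loadParams n) (hdet : (net.reducedJacobian u ξ).det ≠ 0) :
    (u, ξ) ∈ net.semipositiveStates ↔ (u, ξ) ∈ net.nonnegStates := by
  constructor
  · rintro ⟨hv, hpos⟩
    have hl := ell_nonneg hphi hv
    have hZ := isZMatrix_reducedJacobian_of_loadParams hphi hξ hl
    exact ⟨hl, (hZ.isSemipositive_iff_of_det_ne_zero hdet).1 hpos⟩
  · rintro ⟨hl, hnonneg⟩
    have hp := pLine_nonneg hphi (fun j => (hξ j).1) hl
    have hq := qLine_nonneg hphi (fun j => (hξ j).2) hl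
    have hZ := net.isZMatrix_reducedJacobian ξ hp hq hl
    have hpos := (hZ.isSemipositive_iff_of_det_ne_zero hdet).2 hnonneg
    exact ⟨fun j => (hZ.diag_pos hpos j).trans_le (net.reducedJacobian_diag_le ξ hp hq hl j), hpos⟩

theorem subset_semipositiveStates_of_isPreconnected {C : Set (Vars n × Params n)}
    (hC : IsPreconnected C) (hphi : ∀ s ∈ C, net.phi s.1 s.2 = 0)
    (hload : ∀ s ∈ C, s.2 ∈ loadParams n) (hdet : ∀ s ∈ C, (net.reducedJacobian s.1 s.2).det ≠ 0)
    (hne : (C ∩ net.semipositiveStates).Nonempty) : C ⊆ net.semipositiveStates := by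
  refine subset_of_isPreconnected_of_inter_eq hC net.isOpen_semipositiveStates
    net.isClosed_nonnegStates ?_ hne
  ext s
  exact and_congr_right fun hs =>
    mem_semipositiveStates_iff_mem_nonnegStates (hphi s hs) (hload s hs) (hdet s hs)

variable (net)

theorem flat_mem_semipositiveStates : (flatVars n, flatParams n) ∈ net.semipositiveStates := by
  refine ⟨fun j => ?_, ?_⟩
  · rw [busV_flat]
    exact zero_lt_one
  · simpa only [reducedJacobian_flat] using isSemipositive_one

theorem voltageStabilityRegion_subset_semipositiveStates :
    net.voltageStabilityRegion (loadParams n) ⊆ net.semipositiveStates := by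
  intro s hs
  have hregular : net.voltageStabilityRegion (loadParams n) ⊆ net.regularSolutions (loadParams n) :=
    connectedComponentIn_subset _ _
  have hflat : (flatVars n, flatParams n) ∈ net.voltageStabilityRegion (loadParams n) :=
    mem_connectedComponentIn (connectedComponentIn_nonempty_iff.1 ⟨s, hs⟩)
  exact subset_semipositiveStates_of_isPreconnected isPreconnected_connectedComponentIn
    (fun s hs => (hregular hs).1) (fun s hs => (hregular hs).2.2.1)
    (fun s hs => net.reducedJacobian_det_ne_zero (hregular hs).2.2.2)
    ⟨_, hflat, net.flat_mem_semipositiveStates⟩ hs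

end Stability

end RadialNetwork

theorem mainTheorem2 {n : ℕ} (net : RadialNetwork n) (u : Vars n) (ξ : Params n)
    (h : (u, ξ) ∈ net.voltageStabilityRegion (loadParams n)) :
    (∀ j, net.reducedJacobian u ξ j j = net.diagEntry u ξ j) ∧
      0 < (net.reducedJacobian u ξ).det ∧
      (net.reducedJacobian u ξ).det ≤ net.detApprox u ξ := by
  obtain ⟨hphi, -, hload, -⟩ := connectedComponentIn_subset _ _ h
  obtain ⟨hv, hpos⟩ := net.voltageStabilityRegion_subset_semipositiveStates h
  have hZ := RadialNetwork.isZMatrix_reducedJacobian_of_loadParams hphi hload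
    (RadialNetwork.ell_nonneg hphi hv)
  obtain ⟨hdet, hle⟩ := hZ.det_pos_and_det_le_prod_diag hpos
  have hprod : ∏ j, net.reducedJacobian u ξ j j = net.detApprox u ξ :=
    Finset.prod_congr rfl fun j _ => net.reducedJacobian_diag u ξ j
  exact ⟨net.reducedJacobian_diag u ξ, hdet, hle.trans_eq hprod⟩
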